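/- Scalars are $\mathbb{K}=\mathbb{R}$ or $\mathbb{C}$. For a topological space $X$, let $C_b(X)$ be the algebra of bounded continuous functions $X\to\mathbb{K}$ with the supremum norm; for $f\in C_b(X)$ let $\mathrm{Coz}(f)=\{x: f(x)\neq 0\}$ and $\mathrm{supp}(f)=\mathrm{cl}_X\,\mathrm{Coz}(f)$; let $\mathrm{Coz}(X)=\{\mathrm{Coz}(f):f\in C_b(X)\}$. Let $C_c(X)$ be the set of $f\in C_b(X)$ with compact support and $C_0(X)$ the set of $f\in C_b(X)$ such that $\{x:|f(x)|\ge\varepsilon\}$ is compact for every $\varepsilon>0$. Let $C_{\mathscr P}(X)$ be the set of $f\in C_b(X)$ such that $\mathrm{supp}(f)$ has a Lindelöf neighborhood in $X$ (that is, $\mathrm{supp}(f)\subseteq\mathrm{int}_X N$ for some Lindelöf $N\subseteq X$). For a completely regular Hausdorff space $X$ with Stone–Čech compactification $\beta X$, let $$\lambda_{\mathscr P}X=\bigcup\{\mathrm{int}_{\beta X}\mathrm{cl}_{\beta X}C : C\in\mathrm{Coz}(X)\text{ and }\mathrm{cl}_XC\text{ is Lindelöf}\}\subseteq\beta X ,$$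 with the subspace topology. "Isometrically isomorphic" means isomorphic through a linear, multiplicative, isometric bijection. Theorem. Let $X$ be a paracompact Hausdorff space in which every point has a Lindelöf neighborhood, and let $Y=\lambda_{\mathscr P}X$. Then $C_{\mathscr P}(X)$ is a subalgebra of $C_b(X)$ which is complete in the supremum norm (a Banach subalgebra). The space $Y$ is locally compact Hausdorff, $C_{\mathscr P}(X)$ is isometrically isomorphic to $C_c(Y)$, and every locally compact Hausdorff space $T$ for which $C_{\mathscr P}(X)$ is isometrically isomorphic to $C_c(T)$ is homeomorphic to $Y$. Moreover: 1. $C_{\mathscr P}(X)=\{f\in C_b(X):\mathrm{supp}(f)\text{ is Lindelöf}\}$. 2. $C_0(X)\subseteq C_{\mathscr P}(X)$, and the inclusion is proper if $X$ is not Lindelöf. 3. $C_c(Y)=C_0(Y)$. 4. $Y$ is countably compact. 5. If $X$ is not Lindelöf, then $Y$ is neither Lindelöf nor paracompact. If $X$ is in addition locally compact, then also: 6. $C_{\mathscr P}(X)=\{f\in C_b(X):\mathrm{supp}(f)\text{ is }\sigma\text{-compact}\}$. 7. If $X$ is not Lindelöf, then $Y$ is not normal. -/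

import Mathlib

open scoped BoundedContinuousFunction Topology

noncomputable section

namespace LindelofSupport

/-- Each point has a Lindelöf neighborhood. -/
def LocallyLindelof (X : Type*) [TopologicalSpace X] : Prop :=
  ∀ x : X, ∃ N ∈ 𝓝 x, IsLindelof N

/-- `C_P(X)` for `P` the Lindelöf property: the bounded continuous scalar functions whose support
has a Lindelöf neighborhood. -/
def CLindelof (𝕜 : Type*) [RCLike 𝕜] (X : Type*) [TopologicalSpace X] : Set (X →ᵇ 𝕜) :=
  {f | ∃ N ∈ 𝓝ˢ (tsupport f), IsLindelof N}

/-- `C_0(X)`: the bounded continuous scalar functions `f` for which `{|f| ≥ ε}` is compact for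
each `ε > 0`. -/
def CZero (𝕜 : Type*) [RCLike 𝕜] (X : Type*) [TopologicalSpace X] : Set (X →ᵇ 𝕜) :=
  {f | ∀ ε : ℝ, 0 < ε → IsCompact {x | ε ≤ ‖f x‖}}

/-- `C_c(X)`: the bounded continuous scalar functions with compact support, as a subalgebra of
`C_b(X)` (with the supremum norm). -/
def CCompact (𝕜 : Type*) [RCLike 𝕜] (X : Type*) [TopologicalSpace X] :
    NonUnitalSubalgebra 𝕜 (X →ᵇ 𝕜) where
  carrier := {f | HasCompactSupport f}
  add_mem' {f g} hf hg := by
    have h : HasCompactSupport ((f : X → 𝕜) + (g : X → 𝕜)) := HasCompactSupport.add hf hg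
    simpa using h
  zero_mem' := by
    have h : HasCompactSupport (0 : X → 𝕜) := HasCompactSupport.zero
    simpa using h
  mul_mem' {f g} hf _ := by
    have h : HasCompactSupport ((f : X → 𝕜) * (g : X → 𝕜)) := HasCompactSupport.mul_right hf
    simpa using h
  smul_mem' c f hf := by
    have h : HasCompactSupport ((fun _ : X => c) • (f : X → 𝕜)) := HasCompactSupport.smul_left hf
    exact h

/-- The cozero-sets of `X`: the sets `{x | f x ≠ 0}` for `f ∈ C_b(X)`. -/
def IsCozeroSet (𝕜 : Type*) [RCLike 𝕜] {X : Type*} [TopologicalSpace X] (C : Set X) : Prop :=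
  ∃ f : X →ᵇ 𝕜, C = Function.support f

/-- `λ_P X` for `P` the Lindelöf property, as a subset of the Stone–Čech compactification `βX`:
the union of `int_{βX} cl_{βX} C` over the cozero-sets `C` of `X` whose closure in `X` is
Lindelöf. -/
def lambdaLindelof (𝕜 : Type*) [RCLike 𝕜] (X : Type*) [TopologicalSpace X] :
    Set (StoneCech X) :=
  ⋃ C ∈ {C : Set X | IsCozeroSet 𝕜 C ∧ IsLindelof (closure C)},
    interior (closure (stoneCechUnit '' C))

/-- Two subalgebras of algebras of bounded continuous functions are isometrically isomorphic:
there is a linear isometric bijection between them that is multiplicative. -/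
def IsometricallyIsomorphic {𝕜 : Type*} [RCLike 𝕜] {X Y : Type*} [TopologicalSpace X]
    [TopologicalSpace Y] (A : NonUnitalSubalgebra 𝕜 (X →ᵇ 𝕜))
    (B : NonUnitalSubalgebra 𝕜 (Y →ᵇ 𝕜)) : Prop :=
  ∃ e : A ≃ₗᵢ[𝕜] B, ∀ f g : A, e (f * g) = e f * e g

end LindelofSupport

end

/-!
Chains of overlapping members of a locally finite open cover by sets that lie in Lindelöf sets
partition `X` into clopen Lindelöf pieces, say the fibers of a locally constant map `π : X → Q`.
A function lies in `C_P(X)` if and only if its support meets countably many fibers, and `π` extends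
to a proper map from `λ_P X` onto the space of those ultrafilters on `Q` that have a countable
member. In that space each `σ`-compact set lies in a compact set, hence the same holds in `λ_P X`,
which gives `C_c = C_0` and countable compactness.

If `X` is not Lindelöf then `Q` is uncountable. A right inverse of `π` embeds the space of
ultrafilters as a closed subspace of `λ_P X`, so it suffices that this space is not normal, and
`Q` may be replaced by `ω₁ × ℕ`. A coherent family of finite-to-one functions `e a : [0, a] → ℕ`,
built by Todorčević's minimal walks, gives two disjoint closed sets of free ultrafilters: those that
contain the region on and below the graph of some `e a`, and those that contain the region strictly
above it. If they could be separated by open sets, the principal ultrafilters in one of these would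
form a set `S ⊆ ω₁ × ℕ` whose slice at all but finitely many `x ≤ a` is `[0, e a x]`. As each `e a`
is finite-to-one, only finitely many slices can equal `[0, k]`, for each `k`, and only finitely many
slices can have no such form, which makes `ω₁` countable.

The space `T` is recovered from `C_c(T)` because a character `χ` of `C_c(T)` with `χ g ≠ 0` extends
to the character `F ↦ χ (F * g) / χ g` of `C(T ∪ {∞})`, which is the evaluation at a point.
-/

noncomputable section

open Set Filter Topology

namespace LindelofSupport

section Decomposition

variable {X ι : Type*} {v : ι → Set X}

/-- A set is saturated with respect to a family `v` if it contains each member of `v` that it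
meets. For an open cover, the saturated sets are clopen, and they are the unions of the classes of
points joined by finite chains of overlapping members of `v`. -/
def IsSaturated (v : ι → Set X) (U : Set X) : Prop :=
  ∀ i, (v i ∩ U).Nonempty → v i ⊆ U

/-- The partition of `X` into the classes of points that lie in the same saturated sets. -/
def saturatedSetoid (v : ι → Set X) : Setoid X :=
  Setoid.ker fun x => {U | IsSaturated v U ∧ x ∈ U}

theorem saturatedSetoid_of_mem {i : ι} {x y : X} (hx : x ∈ v i) (hy : y ∈ v i) :
    saturatedSetoid v x y :=
  Set.ext fun _ => and_congr_right fun hU =>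
    ⟨fun hxU => hU i ⟨x, hx, hxU⟩ hy, fun hyU => hU i ⟨y, hy, hyU⟩ hx⟩

theorem IsSaturated.mem_of_saturatedSetoid {U : Set X} (hU : IsSaturated v U) {x y : X}
    (h : saturatedSetoid v x y) (hx : x ∈ U) : y ∈ U :=
  (show U ∈ {U | IsSaturated v U ∧ y ∈ U} from Setoid.ker_def.1 h ▸ ⟨hU, hx⟩).2

variable [TopologicalSpace X]

theorem countable_setOf_inter_nonempty (hv : LocallyFinite v) {K : Set X} (hK : IsLindelof K) :
    {i | (v i ∩ K).Nonempty}.Countable := by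
  choose O hO hOfin using hv
  obtain ⟨t, ht, -, hKt⟩ := hK.elim_nhds_subcover O fun x _ => hO x
  refine (ht.biUnion fun x _ => (hOfin x).countable).mono ?_
  rintro i ⟨y, hyi, hyK⟩
  obtain ⟨x, hx, hyx⟩ := mem_iUnion₂.1 (hKt hyK)
  exact mem_biUnion hx ⟨y, hyi, hyx⟩

theorem exists_isSaturated_isLindelof (hv : LocallyFinite v)
    (hvN : ∀ i, ∃ N, IsLindelof N ∧ v i ⊆ N) {K : Set X} (hK : IsLindelof K) :
    ∃ L, IsLindelof L ∧ K ⊆ L ∧ IsSaturated v L := by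
  choose N hN hvN using hvN
  let star (L : {L : Set X // IsLindelof L}) : {L : Set X // IsLindelof L} :=
    ⟨⋃ i ∈ {i | (v i ∩ L.1).Nonempty}, N i,
      (countable_setOf_inter_nonempty hv L.2).isLindelof_biUnion fun i _ => hN i⟩
  let stars (n : ℕ) : Set X := (star^[n] ⟨K, hK⟩).1
  refine ⟨⋃ n, stars n, isLindelof_iUnion fun n => (star^[n] ⟨K, hK⟩).2,
    subset_iUnion stars 0, ?_⟩
  rintro i ⟨x, hxi, hx⟩
  obtain ⟨n, hn⟩ := mem_iUnion.1 hx
  have hsucc : N i ⊆ stars (n + 1) := by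
    simp only [stars, Function.iterate_succ_apply']
    exact subset_biUnion_of_mem (show i ∈ {i | (v i ∩ stars n).Nonempty} from ⟨x, hxi, hn⟩)
  exact (hvN i).trans (hsucc.trans (subset_iUnion stars (n + 1)))

universe u

theorem exists_locallyConstant_isLindelof_fiber (X : Type u) [TopologicalSpace X]
    [ParacompactSpace X] (hX : LocallyLindelof X) :
    ∃ (Q : Type u) (π : LocallyConstant X Q), Function.Surjective π ∧
      ∀ q, IsLindelof (π ⁻¹' {q}) := by
  choose N hN hNL using hX
  obtain ⟨v, hvo, hvc, hvf, hvN⟩ := precise_refinement (fun x => interior (N x))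
    (fun x => isOpen_interior)
    (eq_univ_of_forall fun x => mem_iUnion_of_mem x (mem_interior_iff_mem_nhds.2 (hN x)))
  let π : LocallyConstant X (Quotient (saturatedSetoid v)) :=
    { toFun := Quotient.mk _
      isLocallyConstant := (IsLocallyConstant.iff_exists_open _).2 fun x => by
        obtain ⟨i, hi⟩ := mem_iUnion.1 (hvc ▸ mem_univ x)
        exact ⟨v i, hvo i, hi, fun y hy => Quotient.sound (saturatedSetoid_of_mem hy hi)⟩ }
  refine ⟨_, π, Quotient.mk_surjective, Quotient.mk_surjective.forall.2 fun x => ?_⟩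
  obtain ⟨L, hL, hxL, hLsat⟩ := exists_isSaturated_isLindelof hvf
    (fun i => ⟨N i, hNL i, (hvN i).trans interior_subset⟩) (isLindelof_singleton (x := x))
  refine hL.of_isClosed_subset (π.isLocallyConstant.isClosed_fiber _) fun y hy => ?_
  exact hLsat.mem_of_saturatedSetoid (Setoid.symm' _ (Quotient.exact hy)) (hxL rfl)

end Decomposition

section Fibers

variable {𝕜 : Type*} [RCLike 𝕜] {X Q : Type*} [TopologicalSpace X] {π : LocallyConstant X Q}

variable (𝕜 X) in
/-- `C_P(X)` as a subalgebra of `C_b(X)`. -/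
def CLindelofSubalgebra : NonUnitalSubalgebra 𝕜 (X →ᵇ 𝕜) where
  carrier := CLindelof 𝕜 X
  add_mem' := by
    rintro f g ⟨M, hfM, hM⟩ ⟨N, hgN, hN⟩
    exact ⟨M ∪ N, nhdsSet_mono (tsupport_add f g) (union_mem_nhdsSet hfM hgN), hM.union hN⟩
  zero_mem' := ⟨∅, by simp, isLindelof_empty⟩
  mul_mem' := by
    rintro f g ⟨N, hfN, hN⟩ -
    exact ⟨N, nhdsSet_mono (tsupport_mul_subset_left (f := f) (g := g)) hfN, hN⟩
  smul_mem' := by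
    rintro c f ⟨N, hfN, hN⟩
    exact ⟨N, nhdsSet_mono (closure_mono (Function.support_const_smul_subset c f)) hfN, hN⟩

theorem countable_image_of_isLindelof (π : LocallyConstant X Q) {A : Set X} (hA : IsLindelof A) :
    (π '' A).Countable := by
  let : TopologicalSpace Q := ⊥
  have : DiscreteTopology Q := ⟨rfl⟩
  exact (hA.image π.continuous).countable_of_discrete

theorem isLindelof_preimage (hπ : ∀ q, IsLindelof (π ⁻¹' {q})) {S : Set Q} (hS : S.Countable) :
    IsLindelof (π ⁻¹' S) := by
  rw [← biUnion_preimage_singleton]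
  exact hS.isLindelof_biUnion fun q _ => hπ q

theorem uncountable_of_not_lindelofSpace (hπ : ∀ q, IsLindelof (π ⁻¹' {q}))
    (hX : ¬ LindelofSpace X) : Uncountable Q := by
  contrapose! hX
  exact ⟨isLindelof_preimage hπ countable_univ⟩

theorem isClopen_preimage (π : LocallyConstant X Q) (S : Set Q) : IsClopen (π ⁻¹' S) :=
  ⟨⟨π.isLocallyConstant Sᶜ⟩, π.isLocallyConstant S⟩

theorem closure_subset_preimage_image (π : LocallyConstant X Q) (A : Set X) :
    closure A ⊆ π ⁻¹' (π '' A) :=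
  closure_minimal (subset_preimage_image π A) (isClopen_preimage π _).isClosed

theorem isLindelof_closure_iff (hπ : ∀ q, IsLindelof (π ⁻¹' {q})) {A : Set X} :
    IsLindelof (closure A) ↔ (π '' A).Countable :=
  ⟨fun h => (countable_image_of_isLindelof π h).mono (image_mono subset_closure), fun h =>
    (isLindelof_preimage hπ h).of_isClosed_subset isClosed_closure
      (closure_subset_preimage_image π A)⟩

theorem mem_CLindelof_iff (hπ : ∀ q, IsLindelof (π ⁻¹' {q})) {f : X →ᵇ 𝕜} :
    f ∈ CLindelof 𝕜 X ↔ (π '' Function.support f).Countable := by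
  constructor
  · rintro ⟨N, hfN, hN⟩
    exact (countable_image_of_isLindelof π hN).mono
      (image_mono ((subset_tsupport f).trans (subset_of_mem_nhdsSet hfN)))
  · intro h
    exact ⟨_, (isClopen_preimage π _).isOpen.mem_nhdsSet.2 (closure_subset_preimage_image π _),
      isLindelof_preimage hπ h⟩

variable (𝕜) in
theorem CLindelof_eq (hπ : ∀ q, IsLindelof (π ⁻¹' {q})) :
    CLindelof 𝕜 X = {f : X →ᵇ 𝕜 | IsLindelof (tsupport f)} :=
  Set.ext fun _ => (mem_CLindelof_iff hπ).trans (isLindelof_closure_iff hπ).symm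

theorem isSigmaCompact_iff_isLindelof [WeaklyLocallyCompactSpace X] {A : Set X}
    (hA : IsClosed A) : IsSigmaCompact A ↔ IsLindelof A := by
  refine ⟨fun h => h.isLindelof, fun h => ?_⟩
  choose K hK hKx using fun x : X => exists_compact_mem_nhds x
  obtain ⟨t, ht, -, hAt⟩ := h.elim_nhds_subcover K fun x _ => hKx x
  exact (isSigmaCompact_biUnion ht fun x _ => (hK x).isSigmaCompact).of_isClosed_subset hA hAt

variable (𝕜) in
theorem isClosed_CLindelof (hπ : ∀ q, IsLindelof (π ⁻¹' {q})) : IsClosed (CLindelof 𝕜 X) := by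
  refine isClosed_of_closure_subset fun f hf => ?_
  obtain ⟨g, hg, hgf⟩ := mem_closure_iff_seq_limit.1 hf
  have hsupport : Function.support f ⊆ ⋃ n, Function.support (g n) := by
    intro x hx
    have hlim : Tendsto (fun n => g n x) atTop (𝓝 (f x)) :=
      ((continuous_eval_const x).tendsto f).comp hgf
    exact mem_iUnion.2 (hlim.eventually_ne hx).exists
  rw [mem_CLindelof_iff hπ]
  refine (countable_iUnion fun n => (mem_CLindelof_iff hπ).1 (hg n)).mono ?_
  rw [← image_iUnion]
  exact image_mono hsupport

theorem support_eq_iUnion_le_norm {Z E : Type*} [NormedAddCommGroup E] (f : Z → E) :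
    Function.support f = ⋃ n : ℕ, {x | 1 / ((n : ℝ) + 1) ≤ ‖f x‖} := by
  ext x
  simp only [Function.mem_support, mem_iUnion, mem_ofPred_eq]
  constructor
  · intro hx
    exact (exists_nat_one_div_lt (norm_pos_iff.2 hx)).imp fun n hn => hn.le
  · rintro ⟨n, hn⟩
    exact norm_pos_iff.1 (Nat.one_div_pos_of_nat.trans_le hn)

theorem isSigmaCompact_support {f : X →ᵇ 𝕜} (hf : f ∈ CZero 𝕜 X) :
    IsSigmaCompact (Function.support f) := by
  rw [support_eq_iUnion_le_norm]
  exact isSigmaCompact_iUnion_of_isCompact _ fun n => hf _ Nat.one_div_pos_of_nat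

variable (𝕜) in
theorem CZero_subset_CLindelof (hπ : ∀ q, IsLindelof (π ⁻¹' {q})) :
    CZero 𝕜 X ⊆ CLindelof 𝕜 X := fun _ hf =>
  (mem_CLindelof_iff hπ).2 (countable_image_of_isLindelof π (isSigmaCompact_support hf).isLindelof)

/-- The indicator function of a clopen set, with values in `𝕜`. -/
def clopenIndicator (𝕜 : Type*) [RCLike 𝕜] {U : Set X} (hU : IsClopen U) : X →ᵇ 𝕜 :=
  BoundedContinuousFunction.ofNormedAddCommGroup (U.indicator 1)
    (continuous_one.indicator fun x hx => by simp [hU.frontier_eq] at hx) 1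
    fun x => (norm_indicator_le_norm_self 1 x).trans_eq norm_one

theorem support_clopenIndicator {U : Set X} (hU : IsClopen U) :
    Function.support (clopenIndicator 𝕜 hU) = U := by
  simp [clopenIndicator]

variable (𝕜) in
theorem CZero_ssubset_CLindelof [Infinite Q] (hsurj : Function.Surjective π)
    (hπ : ∀ q, IsLindelof (π ⁻¹' {q})) : CZero 𝕜 X ⊂ CLindelof 𝕜 X := by
  refine (ssubset_iff_of_subset (CZero_subset_CLindelof 𝕜 hπ)).2 ?_
  obtain ⟨S, hSinf, hScount⟩ : ∃ S : Set Q, S.Infinite ∧ S.Countable :=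
    ⟨range (Infinite.natEmbedding Q),
      infinite_range_of_injective (Infinite.natEmbedding Q).injective, countable_range _⟩
  refine ⟨clopenIndicator 𝕜 (isClopen_preimage π S), ?_, fun h => ?_⟩
  · rwa [mem_CLindelof_iff hπ, support_clopenIndicator, image_preimage_eq S hsurj]
  · have hcompact : IsCompact (π ⁻¹' S) := by
      convert h 1 one_pos using 1
      ext x
      by_cases hx : π x ∈ S <;> simp [clopenIndicator, hx]
    let : TopologicalSpace Q := ⊥
    have : DiscreteTopology Q := ⟨rfl⟩
    refine hSinf ?_
    rw [← image_preimage_eq S hsurj]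
    exact (hcompact.image π.continuous).finite_of_discrete

end Fibers

section StronglyOmegaBounded

variable {Y Z : Type*} [TopologicalSpace Y] [TopologicalSpace Z]

variable (Y) in
/-- A space is strongly `ω`-bounded if each of its `σ`-compact subsets lies in a compact one. -/
def StronglyOmegaBounded : Prop :=
  ∀ A : Set Y, IsSigmaCompact A → ∃ K, IsCompact K ∧ A ⊆ K

theorem StronglyOmegaBounded.of_isProperMap (hZ : StronglyOmegaBounded Z) {f : Y → Z}
    (hf : IsProperMap f) : StronglyOmegaBounded Y := by
  intro A hA
  obtain ⟨K, hK, hAK⟩ := hZ (f '' A) (hA.image hf.continuous)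
  exact ⟨f ⁻¹' K, hf.isCompact_preimage hK, image_subset_iff.1 hAK⟩

theorem StronglyOmegaBounded.countablyCompactSpace (hY : StronglyOmegaBounded Y) :
    CountablyCompactSpace Y := by
  rw [← isCountablyCompact_univ_iff, isCountablyCompact_iff_seq_clusterPt]
  intro y _
  obtain ⟨K, hK, hyK⟩ := hY (range y) <| by
    rw [← iUnion_singleton_eq_range]
    exact isSigmaCompact_iUnion_of_isCompact _ fun _ => isCompact_singleton
  obtain ⟨a, -, ha⟩ := hK.isCountablyCompact.seq_clusterPt y
    (Eventually.of_forall fun n => hyK (mem_range_self n))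
  exact ⟨a, mem_univ a, ha⟩

theorem StronglyOmegaBounded.CCompact_eq_CZero {𝕜 : Type*} [RCLike 𝕜] [R1Space Y]
    (hY : StronglyOmegaBounded Y) : (CCompact 𝕜 Y : Set (Y →ᵇ 𝕜)) = CZero 𝕜 Y := by
  ext f
  constructor
  · intro (hf : HasCompactSupport f) ε hε
    refine hf.isCompact.of_isClosed_subset
      (isClosed_le continuous_const f.continuous.norm) fun y hy => subset_tsupport f ?_
    exact norm_pos_iff.1 (hε.trans_le hy)
  · intro hf
    obtain ⟨K, hK, hfK⟩ := hY _ (isSigmaCompact_support hf)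
    exact HasCompactSupport.of_support_subset_isCompact hK hfK

end StronglyOmegaBounded

section CountableUltrafilters

variable {D E : Type*}

variable (D) in
/-- The subspace of `βD`, for discrete `D`, of the ultrafilters that contain a countable set. -/
def countableUltrafilters : Set (Ultrafilter D) :=
  {u | ∃ S ∈ u, S.Countable}

theorem isClopen_mem_countableUltrafilters (S : Set D) :
    IsClopen {u : countableUltrafilters D | S ∈ u.1} :=
  ⟨(ultrafilter_isClosed_basic S).preimage continuous_subtype_val,
    (ultrafilter_isOpen_basic S).preimage continuous_subtype_val⟩

theorem isCompact_mem_countableUltrafilters {S : Set D} (hS : S.Countable) :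
    IsCompact {u : countableUltrafilters D | S ∈ u.1} := by
  rw [Subtype.isCompact_iff]
  convert (ultrafilter_isClosed_basic S).isCompact using 1
  ext u
  exact ⟨by rintro ⟨u, hu, rfl⟩; exact hu, fun hu => ⟨⟨u, S, hu, hS⟩, hu, rfl⟩⟩

theorem exists_countable_forall_mem {K : Set (countableUltrafilters D)} (hK : IsCompact K) :
    ∃ S : Set D, S.Countable ∧ ∀ u ∈ K, S ∈ u.1 := by
  refine hK.induction_on (p := fun K => ∃ S : Set D, S.Countable ∧ ∀ u ∈ K, S ∈ u.1)
    ⟨∅, countable_empty, by simp⟩ ?_ ?_ ?_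
  · exact fun A B hAB ⟨S, hS, hB⟩ => ⟨S, hS, fun u hu => hB u (hAB hu)⟩
  · rintro A B ⟨S, hS, hA⟩ ⟨T, hT, hB⟩
    refine ⟨S ∪ T, hS.union hT, ?_⟩
    rintro u (hu | hu)
    · exact mem_of_superset (hA u hu) subset_union_left
    · exact mem_of_superset (hB u hu) subset_union_right
  · intro u _
    obtain ⟨S, hSu, hS⟩ := u.2
    exact ⟨{v | S ∈ v.1}, mem_nhdsWithin_of_mem_nhds
      ((isClopen_mem_countableUltrafilters S).isOpen.mem_nhds hSu), S, hS, fun _ hv => hv⟩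

variable (D) in
theorem stronglyOmegaBounded_countableUltrafilters :
    StronglyOmegaBounded (countableUltrafilters D) := by
  rintro _ ⟨K, hK, rfl⟩
  choose S hS hKS using fun n => exists_countable_forall_mem (hK n)
  refine ⟨_, isCompact_mem_countableUltrafilters (countable_iUnion hS),
    iUnion_subset fun n u hu => ?_⟩
  exact mem_of_superset (hKS n u hu) (subset_iUnion S n)

/-- The map between spaces of ultrafilters with a countable member that is induced by a map of the
underlying sets. -/
def mapCountableUltrafilters (f : D → E) (u : countableUltrafilters D) :
    countableUltrafilters E :=
  ⟨u.1.map f, by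
    obtain ⟨S, hSu, hS⟩ := u.2
    exact ⟨f '' S, Filter.image_mem_map hSu, hS.image f⟩⟩

theorem continuous_mapCountableUltrafilters (f : D → E) :
    Continuous (mapCountableUltrafilters f) := by
  refine Continuous.subtype_mk (ultrafilterBasis_is_basis.continuous_iff.2 ?_) _
  rintro _ ⟨S, rfl⟩
  exact (isClopen_mem_countableUltrafilters (f ⁻¹' S)).isOpen

theorem leftInverse_mapCountableUltrafilters {f : D → E} {g : E → D}
    (h : Function.LeftInverse g f) :
    Function.LeftInverse (mapCountableUltrafilters g) (mapCountableUltrafilters f) := fun u =>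
  Subtype.ext (by simp [mapCountableUltrafilters, Ultrafilter.map_map, h.comp_eq_id])

theorem isClosed_free_countableUltrafilters :
    IsClosed {u : countableUltrafilters D | (u.1 : Filter D) ≤ cofinite} := by
  have : {u : countableUltrafilters D | (u.1 : Filter D) ≤ cofinite} =
      ⋂ F ∈ {F : Set D | F.Finite}, {u | Fᶜ ∈ u.1} := by
    ext u
    simp only [mem_iInter, mem_ofPred_eq]
    exact ⟨fun hu F hF => hu hF.compl_mem_cofinite,
      fun hu F hF => compl_compl F ▸ hu Fᶜ (mem_cofinite.1 hF)⟩
  rw [this]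
  exact isClosed_biInter fun F _ => (isClopen_mem_countableUltrafilters Fᶜ).isClosed

theorem mem_ultrafilter_of_diff_finite {u : Ultrafilter D} (hu : (u : Filter D) ≤ cofinite)
    {A B : Set D} (hA : A ∈ u) (hAB : (A \ B).Finite) : B ∈ u := by
  filter_upwards [hA, hu hAB.compl_mem_cofinite] with q hqA hq
  exact not_not.1 fun hqB => hq ⟨hqA, hqB⟩

variable {I : Type*} {L M : I → Set D}

variable (L) in
/-- The free ultrafilters in `countableUltrafilters D` that contain a member of the family `L`. -/
def freeUltrafiltersOn : Set (countableUltrafilters D) :=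
  {u | (u.1 : Filter D) ≤ cofinite ∧ ∃ a, L a ∈ u.1}

theorem exists_mem_freeUltrafiltersOn {a : I} (hLa : (L a).Countable) {A : Set D}
    (hA : A.Infinite) (hAL : A ⊆ L a) : ∃ u ∈ freeUltrafiltersOn L, A ∈ u.1 := by
  have := hA.cofinite_inf_principal_neBot
  obtain ⟨u, hu⟩ := Ultrafilter.exists_le (cofinite ⊓ 𝓟 A)
  have hAu : A ∈ u := hu.trans inf_le_right (mem_principal_self A)
  have hLu : L a ∈ u := mem_of_superset hAu hAL
  exact ⟨⟨u, L a, hLu, hLa⟩, ⟨hu.trans inf_le_left, a, hLu⟩, hAu⟩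

theorem isClosed_freeUltrafiltersOn
    (hL : ∀ S : Set D, S.Countable → ∃ a, ∀ b, ((S ∩ L b) \ L a).Finite) :
    IsClosed (freeUltrafiltersOn L) := by
  refine isClosed_of_closure_subset fun u hu => ?_
  obtain ⟨S, hSu, hS⟩ := u.2
  obtain ⟨a, ha⟩ := hL S hS
  have hsubset : {v | S ∈ v.1} ∩ freeUltrafiltersOn L ⊆
      {v | (v.1 : Filter D) ≤ cofinite} ∩ {v | L a ∈ v.1} := fun v ⟨hSv, hfree, b, hb⟩ =>
    ⟨hfree, mem_ultrafilter_of_diff_finite hfree (inter_mem hSv hb) (ha b)⟩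
  have hclosed := isClosed_free_countableUltrafilters.inter
    (isClopen_mem_countableUltrafilters (L a)).isClosed
  have hua := closure_minimal hsubset hclosed
    ((isClopen_mem_countableUltrafilters S).isOpen.inter_closure ⟨hSu, hu⟩)
  exact ⟨hua.1, a, hua.2⟩

theorem disjoint_freeUltrafiltersOn (hLM : ∀ a b, (L a ∩ M b).Finite) :
    Disjoint (freeUltrafiltersOn L) (freeUltrafiltersOn M) := by
  rw [Set.disjoint_left]
  rintro u ⟨hfree, a, ha⟩ ⟨-, b, hb⟩
  refine u.1.empty_notMem (mem_ultrafilter_of_diff_finite hfree (inter_mem ha hb) ?_)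
  simpa using hLM a b

/-- The points of `D`, as principal ultrafilters. -/
def principalCountableUltrafilter (q : D) : countableUltrafilters D :=
  ⟨pure q, {q}, mem_singleton q, countable_singleton q⟩

theorem preimage_principalCountableUltrafilter_mem {U : Set (countableUltrafilters D)}
    (hU : IsOpen U) {u : countableUltrafilters D} (hu : u ∈ U) :
    principalCountableUltrafilter ⁻¹' U ∈ u.1 := by
  have htendsto : Tendsto principalCountableUltrafilter (u.1 : Filter D) (𝓝 u) :=
    tendsto_subtype_rng.2 (Ultrafilter.tendsto_pure_self u.1)
  exact htendsto (hU.mem_nhds hu)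

theorem exists_almost_separating_set [NormalSpace (countableUltrafilters D)]
    (hLcount : ∀ a, (L a).Countable) (hMcount : ∀ a, (M a).Countable)
    (hL : ∀ S : Set D, S.Countable → ∃ a, ∀ b, ((S ∩ L b) \ L a).Finite)
    (hM : ∀ S : Set D, S.Countable → ∃ a, ∀ b, ((S ∩ M b) \ M a).Finite)
    (hLM : ∀ a b, (L a ∩ M b).Finite) :
    ∃ S : Set D, (∀ a, (L a \ S).Finite) ∧ ∀ a, (M a ∩ S).Finite := by
  obtain ⟨U, V, hU, hV, hLU, hMV, hUV⟩ := normal_separation (isClosed_freeUltrafiltersOn hL)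
    (isClosed_freeUltrafiltersOn hM) (disjoint_freeUltrafiltersOn hLM)
  refine ⟨principalCountableUltrafilter ⁻¹' U, fun a => ?_, fun a => ?_⟩
  · by_contra hinf
    obtain ⟨u, hu, hmem⟩ := exists_mem_freeUltrafiltersOn (hLcount a) hinf sdiff_subset
    obtain ⟨q, hqU, hq⟩ := u.1.nonempty_of_mem
      (inter_mem (preimage_principalCountableUltrafilter_mem hU (hLU hu)) hmem)
    exact hq.2 hqU
  · by_contra hinf
    obtain ⟨u, hu, hmem⟩ := exists_mem_freeUltrafiltersOn (hMcount a) hinf inter_subset_left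
    obtain ⟨q, hqV, hq⟩ := u.1.nonempty_of_mem
      (inter_mem (preimage_principalCountableUltrafilter_mem hV (hMV hu)) hmem)
    exact Set.disjoint_left.1 hUV hq.2 hqV

end CountableUltrafilters

section Coherent

variable {W : Type*} [LinearOrder W]

/-- A coherent family of finite-to-one functions `e a : {x | x ≤ a} → ℕ`: any two of them differ
only finitely often on their common domain. Each `e a` is encoded as a total function whose values
above `a` are irrelevant. -/
structure IsCoherentFiniteToOne (e : W → W → ℕ) : Prop where
  finite_le : ∀ a k, {x | x ≤ a ∧ e a x ≤ k}.Finite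
  finite_ne : ∀ a b, {x | x ≤ a ∧ x ≤ b ∧ e a x ≠ e b x}.Finite

section MaxWeight

/-- The first step of the minimal walk from `a` down to `x` along the enumerations `s a` of the
predecessors of `a`: it leads to `s a (nextIndex s a x)`. The value for `a ≤ x` is irrelevant. -/
def nextIndex (s : W → ℕ → W) (a x : W) : ℕ :=
  sInf {n | x ≤ s a n ∧ s a n < a}

open Classical in
/-- The maximal index used by the minimal walk from `a` down to `x`, which is `0` for the
empty walk. -/
def maxWeight [WellFoundedLT W] (s : W → ℕ → W) (a x : W) : ℕ :=
  if _h : ∃ n, x ≤ s a n ∧ s a n < a then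
    max (maxWeight s (s a (nextIndex s a x)) x) (nextIndex s a x)
  else 0
termination_by wellFounded_lt (α := W).wrap a
decreasing_by exact (Nat.sInf_mem _h).2

variable {s : W → ℕ → W} {a b x : W}

theorem exists_index_of_lt (hs : ∀ a, Iio a ⊆ range (s a)) (hx : x < a) :
    ∃ n, x ≤ s a n ∧ s a n < a := by
  obtain ⟨n, hn⟩ := hs a hx
  exact ⟨n, hn.ge, hn ▸ hx⟩

theorem nextIndex_spec (hs : ∀ a, Iio a ⊆ range (s a)) (hx : x < a) :
    x ≤ s a (nextIndex s a x) ∧ s a (nextIndex s a x) < a :=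
  Nat.sInf_mem (exists_index_of_lt hs hx)

theorem nextIndex_le {n : ℕ} (hx : x ≤ s a n) (hn : s a n < a) : nextIndex s a x ≤ n :=
  Nat.sInf_le ⟨hx, hn⟩

variable [WellFoundedLT W]

theorem maxWeight_of_lt (hs : ∀ a, Iio a ⊆ range (s a)) (hx : x < a) :
    maxWeight s a x = max (maxWeight s (s a (nextIndex s a x)) x) (nextIndex s a x) := by
  rw [maxWeight, dif_pos (exists_index_of_lt hs hx)]

theorem finite_maxWeight_le (hs : ∀ a, Iio a ⊆ range (s a)) (a : W) (k : ℕ) :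
    {x | x ≤ a ∧ maxWeight s a x ≤ k}.Finite := by
  induction a using WellFoundedLT.induction with
  | ind a ih =>
  have hfin : (⋃ n ∈ {n | n ≤ k ∧ s a n < a},
      {x | x ≤ s a n ∧ maxWeight s (s a n) x ≤ k}).Finite :=
    ((finite_Iic k).sep _).biUnion fun n hn => ih _ hn.2
  refine (hfin.insert a).subset ?_
  rintro x ⟨hxa, hxk⟩
  rcases hxa.eq_or_lt with rfl | hlt
  · exact mem_insert _ _
  · rw [maxWeight_of_lt hs hlt, max_le_iff] at hxk
    obtain ⟨hx, hn⟩ := nextIndex_spec hs hlt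
    exact Or.inr (mem_biUnion ⟨hxk.2, hn⟩ ⟨hx, hxk.1⟩)

theorem finite_maxWeight_ne_of_lt (hs : ∀ a, Iio a ⊆ range (s a)) (hb : b < a)
    (ih : ∀ c < a, {x | x ≤ c ∧ x ≤ b ∧ maxWeight s c x ≠ maxWeight s b x}.Finite) :
    {x | x ≤ a ∧ x ≤ b ∧ maxWeight s a x ≠ maxWeight s b x}.Finite := by
  obtain ⟨m, hm⟩ := hs a hb
  have hfin : (⋃ n ∈ {n | n ≤ m ∧ s a n < a}, ({x | x ≤ s a n ∧ maxWeight s (s a n) x ≤ n} ∪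
      {x | x ≤ s a n ∧ x ≤ b ∧ maxWeight s (s a n) x ≠ maxWeight s b x})).Finite :=
    ((finite_Iic m).sep _).biUnion fun n hn => (finite_maxWeight_le hs _ n).union (ih _ hn.2)
  refine hfin.subset ?_
  rintro x ⟨-, hxb, hne⟩
  have hxa := hxb.trans_lt hb
  obtain ⟨hx, hn⟩ := nextIndex_spec hs hxa
  have hnm : nextIndex s a x ≤ m := nextIndex_le (hxb.trans_eq hm.symm) (hm ▸ hb)
  refine mem_biUnion ⟨hnm, hn⟩ ?_
  by_cases hle : maxWeight s (s a (nextIndex s a x)) x ≤ nextIndex s a x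
  · exact Or.inl ⟨hx, hle⟩
  · rw [maxWeight_of_lt hs hxa, max_eq_left (not_le.1 hle).le] at hne
    exact Or.inr ⟨hx, hxb, hne⟩

theorem finite_maxWeight_ne (hs : ∀ a, Iio a ⊆ range (s a)) (a b : W) :
    {x | x ≤ a ∧ x ≤ b ∧ maxWeight s a x ≠ maxWeight s b x}.Finite := by
  have symm {a b} (h : {x | x ≤ a ∧ x ≤ b ∧ maxWeight s a x ≠ maxWeight s b x}.Finite) :
      {x | x ≤ b ∧ x ≤ a ∧ maxWeight s b x ≠ maxWeight s a x}.Finite :=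
    h.subset fun x hx => ⟨hx.2.1, hx.1, hx.2.2.symm⟩
  induction a using WellFoundedLT.induction generalizing b with | ind a iha
  induction b using WellFoundedLT.induction with | ind b ihb
  rcases lt_trichotomy b a with hba | rfl | hab
  · exact finite_maxWeight_ne_of_lt hs hba fun c hc => iha c hc b
  · simp
  · exact symm (finite_maxWeight_ne_of_lt hs hab fun c hc => symm (ihb c hc))

end MaxWeight

theorem exists_isCoherentFiniteToOne [WellFoundedLT W] (hW : ∀ a : W, (Iio a).Countable) :
    ∃ e : W → W → ℕ, IsCoherentFiniteToOne e := by
  have hs (a : W) : ∃ f : ℕ → W, Iio a ⊆ range f :=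
    have : Nonempty W := ⟨a⟩
    countable_iff_exists_subset_range.1 (hW a)
  choose s hs using hs
  exact ⟨maxWeight s, finite_maxWeight_le hs, finite_maxWeight_ne hs⟩

section Uncountable

variable [Uncountable W]

theorem bddAbove_of_countable (hW : ∀ a : W, (Iio a).Countable) {S : Set W}
    (hS : S.Countable) : BddAbove S := by
  by_contra! h
  refine not_countable_univ (α := W) ((hS.biUnion fun x _ => hW x).mono fun a _ => ?_)
  obtain ⟨x, hx, hax⟩ := not_bddAbove_iff.1 h a
  exact mem_biUnion hx hax

theorem finite_of_forall_inter_Iic (hW : ∀ a : W, (Iio a).Countable) {B : Set W}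
    (hB : ∀ a, (Iic a ∩ B).Finite) : B.Finite := by
  by_contra hinf
  let f := Set.Infinite.natEmbedding B hinf
  obtain ⟨a, ha⟩ := bddAbove_of_countable hW (countable_range fun n => (f n : W))
  refine Set.infinite_range_of_injective (f := fun n => (f n : W))
    (Subtype.val_injective.comp f.injective) ((hB a).subset ?_)
  rintro _ ⟨n, rfl⟩
  exact ⟨ha (mem_range_self n), (f n).2⟩

end Uncountable

/-- The region on and below the graph of `e a`. -/
def hypograph (e : W → W → ℕ) (a : W) : Set (W × ℕ) :=
  {q | q.1 ≤ a ∧ q.2 ≤ e a q.1}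

/-- The region strictly above the graph of `e a`. -/
def strictEpigraph (e : W → W → ℕ) (a : W) : Set (W × ℕ) :=
  {q | q.1 ≤ a ∧ e a q.1 < q.2}

variable {e : W → W → ℕ}

theorem IsCoherentFiniteToOne.finite_hypograph_inter_strictEpigraph
    (he : IsCoherentFiniteToOne e) (a b : W) :
    (hypograph e a ∩ strictEpigraph e b).Finite := by
  refine ((he.finite_ne a b).biUnion fun x _ =>
    (finite_Iic (e a x)).image (Prod.mk x)).subset ?_
  rintro ⟨x, n⟩ ⟨⟨hxa, hna⟩, hxb, hnb⟩
  exact mem_biUnion ⟨hxa, hxb, (hnb.trans_le hna).ne'⟩ ⟨n, hna, rfl⟩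

theorem IsCoherentFiniteToOne.not_exists_almost_separating_set [Uncountable W]
    (hW : ∀ a : W, (Iio a).Countable) (he : IsCoherentFiniteToOne e) :
    ¬ ∃ S : Set (W × ℕ),
      (∀ a, (hypograph e a \ S).Finite) ∧ ∀ a, (strictEpigraph e a ∩ S).Finite := by
  rintro ⟨S, hhyp, hepi⟩
  let G (k : ℕ) : Set W := {x | ∀ n, (x, n) ∈ S ↔ n ≤ k}
  have hexc (a : W) : {x | x ≤ a ∧ x ∉ G (e a x)}.Finite := by
    refine (((hhyp a).union (hepi a)).image Prod.fst).subset ?_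
    rintro x ⟨hxa, hx⟩
    obtain ⟨n, hn⟩ := not_forall.1 hx
    refine ⟨(x, n), ?_, rfl⟩
    by_cases hle : n ≤ e a x
    · exact Or.inl ⟨⟨hxa, hle⟩, fun h => hn (iff_of_true h hle)⟩
    · exact Or.inr ⟨⟨hxa, not_le.1 hle⟩, by_contra fun h => hn (iff_of_false h hle)⟩
  have hG (k : ℕ) : (G k).Finite := by
    refine finite_of_forall_inter_Iic hW fun a => ((hexc a).union (he.finite_le a k)).subset ?_
    rintro x ⟨hxa, hx⟩
    by_cases h : x ∈ G (e a x)
    · exact Or.inr ⟨hxa, (hx _).1 ((h _).2 le_rfl)⟩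
    · exact Or.inl ⟨hxa, h⟩
  have hcompl : (⋃ k, G k)ᶜ.Finite := by
    refine finite_of_forall_inter_Iic hW fun a => (hexc a).subset ?_
    rintro x ⟨hxa, hx⟩
    exact ⟨hxa, fun h => hx (mem_iUnion_of_mem _ h)⟩
  refine not_countable_univ (α := W) ?_
  rw [← compl_union_self (⋃ k, G k)]
  exact hcompl.countable.union (countable_iUnion fun k => (hG k).countable)

theorem not_normalSpace_countableUltrafilters_prod [WellFoundedLT W] [Uncountable W]
    (hW : ∀ a : W, (Iio a).Countable) : ¬ NormalSpace (countableUltrafilters (W × ℕ)) := by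
  intro hnormal
  obtain ⟨e, he⟩ := exists_isCoherentFiniteToOne hW
  have hcount (a : W) : {q : W × ℕ | q.1 ≤ a}.Countable := by
    refine (((hW a).insert a).prod (countable_univ (α := ℕ))).mono fun q hq => ?_
    exact ⟨le_iff_eq_or_lt.1 hq, mem_univ _⟩
  have hbound (S : Set (W × ℕ)) (hS : S.Countable) : ∃ a, ∀ q ∈ S, q.1 ≤ a :=
    (bddAbove_of_countable hW (hS.image Prod.fst)).imp fun a ha q hq => ha (mem_image_of_mem _ hq)
  refine he.not_exists_almost_separating_set hW (exists_almost_separating_set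
    (fun a => (hcount a).mono fun q hq => hq.1) (fun a => (hcount a).mono fun q hq => hq.1)
    (fun S hS => ?_) (fun S hS => ?_) he.finite_hypograph_inter_strictEpigraph)
  · obtain ⟨a, ha⟩ := hbound S hS
    refine ⟨a, fun b => (he.finite_hypograph_inter_strictEpigraph b a).subset ?_⟩
    rintro q ⟨⟨hqS, hqb⟩, hqa⟩
    exact ⟨hqb, ha q hqS, not_le.1 fun h => hqa ⟨ha q hqS, h⟩⟩
  · obtain ⟨a, ha⟩ := hbound S hS
    refine ⟨a, fun b => (he.finite_hypograph_inter_strictEpigraph a b).subset ?_⟩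
    rintro q ⟨⟨hqS, hqb⟩, hqa⟩
    exact ⟨⟨ha q hqS, not_lt.1 fun h => hqa ⟨ha q hqS, h⟩⟩, hqb⟩

theorem not_normalSpace_countableUltrafilters (D : Type*) [Uncountable D] :
    ¬ NormalSpace (countableUltrafilters D) := by
  intro hnormal
  let W : Type := (Cardinal.aleph 1).ord.ToType
  have hWcard : Cardinal.mk W = Cardinal.aleph 1 := Cardinal.mk_ord_toType _
  have hW (a : W) : (Iio a).Countable := by
    rw [← Cardinal.le_aleph0_iff_set_countable, ← Cardinal.lt_aleph_one_iff]
    exact (Cardinal.mk_Iio_lt a (by simp [W])).trans_eq hWcard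
  have : Uncountable W := by
    rw [← Cardinal.aleph0_lt_mk_iff, hWcard]
    exact Cardinal.aleph0_lt_aleph_one
  obtain ⟨j⟩ : Nonempty ((W × ℕ) ↪ D) := by
    rw [← Cardinal.lift_mk_le']
    simp [hWcard]
  refine not_normalSpace_countableUltrafilters_prod hW ?_
  exact ((leftInverse_mapCountableUltrafilters
    (Function.leftInverse_invFun j.injective)).isClosedEmbedding
    (continuous_mapCountableUltrafilters _) (continuous_mapCountableUltrafilters _)).normalSpace

end Coherent

section BanachStone

variable {𝕜 : Type*} [RCLike 𝕜] {S T : Type*} [TopologicalSpace S] [TopologicalSpace T]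

namespace CCompact

/-- A continuous function with compact support as an element of `CCompact 𝕜 T`. -/
def mk (f : C(T, 𝕜)) (hf : HasCompactSupport f) : CCompact 𝕜 T :=
  ⟨BoundedContinuousFunction.ofNormedAddCommGroup f f.continuous _
    (hf.exists_bound_of_continuous f.continuous).choose_spec, hf⟩

@[simp]
theorem mk_apply (f : C(T, 𝕜)) (hf : HasCompactSupport f) (t : T) : (mk f hf).1 t = f t :=
  rfl

/-- The product `F * f` of a continuous function and a compactly supported one. -/
def continuousMul (F : C(T, 𝕜)) (f : CCompact 𝕜 T) : CCompact 𝕜 T :=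
  mk (F * f.1.toContinuousMap) (HasCompactSupport.mul_left f.2)

/-- The extension of a compactly supported function by `0` to the point at infinity. -/
def toOnePoint (f : CCompact 𝕜 T) : C(OnePoint T, 𝕜) :=
  OnePoint.continuousMapMk f.1.toContinuousMap 0
    (tendsto_const_nhds.congr' (hasCompactSupport_iff_eventuallyEq.1 f.2).symm)

variable (𝕜) in
theorem exists_eq_one [R1Space T] [LocallyCompactSpace T] {t : T} {U : Set T}
    (hU : IsOpen U) (ht : t ∈ U) : ∃ f : CCompact 𝕜 T, f.1 t = 1 ∧ ∀ x ∉ U, f.1 x = 0 := by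
  obtain ⟨f, hf1, hf0, hf, -⟩ := exists_continuous_one_zero_of_isCompact
    (isCompact_singleton (x := t)) hU.isClosed_compl (disjoint_compl_right_iff_subset.2 (by simpa))
  refine ⟨mk ⟨fun x => f x, RCLike.continuous_ofReal.comp f.continuous⟩
    (hf.comp_left (g := fun r : ℝ => (r : 𝕜)) RCLike.ofReal_zero), ?_, fun x hx => ?_⟩
  · simp [hf1 (mem_singleton t)]
  · simp [hf0 hx]

theorem eq_of_forall_apply_eq [T2Space T] [LocallyCompactSpace T] {s t : T}
    (h : ∀ f : CCompact 𝕜 T, f.1 s = f.1 t) : s = t := by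
  by_contra hst
  obtain ⟨f, hf1, hf0⟩ := exists_eq_one 𝕜 (isOpen_compl_singleton (x := t)) hst
  exact one_ne_zero (hf1.symm.trans ((h f).trans (hf0 t (by simp))))

/-- The character `F ↦ χ (F * g) / χ g` of `C(T ∪ {∞})` that extends a character `χ` of `C_c(T)`
with `χ g ≠ 0`. -/
def extendCharacter (χ : CCompact 𝕜 T →ₙₐ[𝕜] 𝕜) (g : CCompact 𝕜 T) (hg : χ g ≠ 0) :
    C(OnePoint T, 𝕜) →ₐ[𝕜] 𝕜 :=
  let mulG (F : C(OnePoint T, 𝕜)) : CCompact 𝕜 T :=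
    continuousMul (F.comp ⟨(↑), OnePoint.continuous_coe⟩) g
  AlgHom.ofLinearMap
    { toFun := fun F => χ (mulG F) / χ g
      map_add' := fun F G => by
        have hadd : mulG (F + G) = mulG F + mulG G := by
          ext t
          exact add_mul _ _ _
        rw [hadd, map_add, add_div]
      map_smul' := fun c F => by
        have hsmul : mulG (c • F) = c • mulG F := by
          ext t
          exact smul_mul_assoc c (F t) (g.1 t)
        rw [hsmul, map_smul, smul_div_assoc, RingHom.id_apply] }
    (by
      have hone : mulG 1 = g := by
        ext t
        exact one_mul _
      simp [hone, hg])
    (fun F G => by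
      have hmul : mulG (F * G) * g = mulG F * mulG G := by
        ext t
        exact (mul_assoc _ _ _).trans (mul_mul_mul_comm _ _ _ _)
      have hχ := congrArg χ hmul
      simp only [map_mul] at hχ
      change χ (mulG (F * G)) / χ g = χ (mulG F) / χ g * (χ (mulG G) / χ g)
      field_simp
      exact hχ)

theorem extendCharacter_toOnePoint (χ : CCompact 𝕜 T →ₙₐ[𝕜] 𝕜) (g : CCompact 𝕜 T)
    (hg : χ g ≠ 0) (f : CCompact 𝕜 T) : extendCharacter χ g hg (toOnePoint f) = χ f := by
  change χ (f * g) / χ g = χ f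
  rw [map_mul, mul_div_cancel_right₀ _ hg]

theorem exists_eq_eval_of_algHom {K : Type*} [TopologicalSpace K] [CompactSpace K] [T2Space K]
    (ψ : C(K, 𝕜) →ₐ[𝕜] 𝕜) : ∃ p, ∀ F, ψ F = F p := by
  obtain ⟨p, hp⟩ := (WeakDual.CharacterSpace.continuousMapEval_bijective (X := K) (𝕜 := 𝕜)).2
    (WeakDual.CharacterSpace.equivAlgHom.symm ψ)
  refine ⟨p, fun F => ?_⟩
  rw [← WeakDual.CharacterSpace.equivAlgHom_symm_coe ψ, ← hp]
  rfl

theorem exists_eq_eval [T2Space T] [LocallyCompactSpace T] {χ : CCompact 𝕜 T →ₙₐ[𝕜] 𝕜}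
    (hχ : χ ≠ 0) : ∃ t, ∀ f, χ f = f.1 t := by
  obtain ⟨g, hg⟩ := DFunLike.ne_iff.1 hχ
  obtain ⟨p, hp⟩ := exists_eq_eval_of_algHom (extendCharacter χ g hg)
  have heval (f : CCompact 𝕜 T) : χ f = toOnePoint f p := by
    rw [← hp, extendCharacter_toOnePoint]
  induction p using OnePoint.rec with
  | infty => exact absurd (heval g) hg
  | coe t => exact ⟨t, heval⟩

theorem exists_eq_comp [R1Space S] [LocallyCompactSpace S] [T2Space T] [LocallyCompactSpace T]
    {φ : CCompact 𝕜 T →ₙₐ[𝕜] CCompact 𝕜 S} (hφ : Function.Surjective φ) :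
    ∃ τ : S → T, Continuous τ ∧ ∀ f s, (φ f).1 s = f.1 (τ s) := by
  have hτ (s : S) : ∃ t, ∀ f, (φ f).1 s = f.1 t := by
    let χ : CCompact 𝕜 T →ₙₐ[𝕜] 𝕜 :=
      { toFun := fun f => (φ f).1 s
        map_smul' := fun c f => by simp
        map_zero' := by simp
        map_add' := fun f g => by simp
        map_mul' := fun f g => by simp }
    obtain ⟨g, hg, -⟩ := exists_eq_one 𝕜 isOpen_univ (mem_univ s)
    obtain ⟨f, rfl⟩ := hφ g
    exact exists_eq_eval (χ := χ) (DFunLike.ne_iff.2 ⟨f, hg.trans_ne one_ne_zero⟩)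
  choose τ hτ using hτ
  refine ⟨τ, continuous_iff_continuousAt.2 fun s => ?_, fun f s => hτ s f⟩
  refine (nhds_basis_opens (τ s)).tendsto_right_iff.2 fun U ⟨hs, hU⟩ => ?_
  obtain ⟨f, hf1, hf0⟩ := exists_eq_one 𝕜 hU hs
  have hne : (φ f).1 s ≠ 0 := by rw [hτ, hf1]; exact one_ne_zero
  filter_upwards [(φ f).1.continuous.continuousAt.eventually_ne hne] with x hx
  by_contra hxU
  exact hx ((hτ x f).trans (hf0 _ hxU))

theorem nonempty_homeomorph [T2Space S] [LocallyCompactSpace S] [T2Space T]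
    [LocallyCompactSpace T] {φ : CCompact 𝕜 T →ₙₐ[𝕜] CCompact 𝕜 S}
    (hφ : Function.Bijective φ) : Nonempty (S ≃ₜ T) := by
  obtain ⟨inv, hleft, hright⟩ := Function.bijective_iff_has_inverse.1 hφ
  let ψ := φ.inverse inv hleft hright
  obtain ⟨τ, hτ, hφτ⟩ := exists_eq_comp hφ.2
  obtain ⟨σ, hσ, hψσ⟩ := exists_eq_comp (φ := ψ) hleft.surjective
  exact ⟨{
    toFun := τ
    invFun := σ
    left_inv := fun s => eq_of_forall_apply_eq (𝕜 := 𝕜) fun f => by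
      rw [← hψσ, ← hφτ]
      exact congrArg (fun g : CCompact 𝕜 S => g.1 s) (hright f)
    right_inv := fun t => eq_of_forall_apply_eq (𝕜 := 𝕜) fun f => by
      rw [← hφτ, ← hψσ]
      exact congrArg (fun g : CCompact 𝕜 T => g.1 t) (hleft f) }⟩

end CCompact

namespace IsometricallyIsomorphic

variable {A : NonUnitalSubalgebra 𝕜 (S →ᵇ 𝕜)} {B : NonUnitalSubalgebra 𝕜 (T →ᵇ 𝕜)}

theorem symm (h : IsometricallyIsomorphic A B) : IsometricallyIsomorphic B A := by
  obtain ⟨e, he⟩ := h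
  exact ⟨e.symm, fun f g => e.injective (by simp [he])⟩

theorem exists_bijective_nonUnitalAlgHom (h : IsometricallyIsomorphic A B) :
    ∃ φ : A →ₙₐ[𝕜] B, Function.Bijective φ := by
  obtain ⟨e, he⟩ := h
  let φ : A →ₙₐ[𝕜] B :=
    { toFun := e
      map_smul' := map_smul e
      map_zero' := map_zero e
      map_add' := map_add e
      map_mul' := he }
  exact ⟨φ, e.bijective⟩

end IsometricallyIsomorphic

end BanachStone

section Lambda

variable {𝕜 : Type*} [RCLike 𝕜] {X Q : Type*} [TopologicalSpace X]

/-- The extension of a locally constant map `π : X → Q` to a map from `βX` to `βQ`, for `Q`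
discrete, where `βQ` is realized as the space of ultrafilters on `Q`. -/
def toUltrafilter (π : LocallyConstant X Q) : StoneCech X → Ultrafilter Q :=
  stoneCechExtend (g := fun x => (pure (π x) : Ultrafilter Q))
    (π.isLocallyConstant.comp pure).continuous

variable (π : LocallyConstant X Q)

theorem continuous_toUltrafilter : Continuous (toUltrafilter π) :=
  continuous_stoneCechExtend _

@[simp]
theorem toUltrafilter_stoneCechUnit (x : X) :
    toUltrafilter π (stoneCechUnit x) = pure (π x) :=
  stoneCechExtend_stoneCechUnit _ x

theorem isClopen_mem_toUltrafilter (S : Set Q) : IsClopen {p | S ∈ toUltrafilter π p} :=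
  ⟨(ultrafilter_isClosed_basic S).preimage (continuous_toUltrafilter π),
    (ultrafilter_isOpen_basic S).preimage (continuous_toUltrafilter π)⟩

theorem closure_image_preimage_eq (S : Set Q) :
    closure (stoneCechUnit '' (π ⁻¹' S)) = {p | S ∈ toUltrafilter π p} := by
  refine Subset.antisymm (closure_minimal ?_ (isClopen_mem_toUltrafilter π S).isClosed) ?_
  · rintro _ ⟨x, hx, rfl⟩
    simpa using hx
  · convert denseRange_stoneCechUnit.subset_closure_image_preimage_of_isOpen
      (isClopen_mem_toUltrafilter π S).isOpen using 3
    ext x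
    simp

theorem exists_leftInverse_toUltrafilter {π : LocallyConstant X Q}
    (hsurj : Function.Surjective π) :
    ∃ φ : Ultrafilter Q → StoneCech X, Continuous φ ∧
      Function.LeftInverse (toUltrafilter π) φ := by
  obtain ⟨s, hs⟩ := hsurj.hasRightInverse
  let φ : Ultrafilter Q → StoneCech X := Ultrafilter.extend fun q => stoneCechUnit (s q)
  have hφ : Continuous φ := continuous_ultrafilter_extend _
  refine ⟨φ, hφ, congrFun (denseRange_pure.equalizer ((continuous_toUltrafilter π).comp hφ)
    continuous_id (funext fun q => ?_))⟩
  simp [φ, hs q]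

variable {π}

theorem lambdaLindelof_eq_preimage (hπ : ∀ q, IsLindelof (π ⁻¹' {q})) :
    lambdaLindelof 𝕜 X = toUltrafilter π ⁻¹' countableUltrafilters Q := by
  ext p
  simp only [lambdaLindelof, mem_iUnion, exists_prop]
  constructor
  · rintro ⟨C, ⟨-, hC⟩, hp⟩
    have hpS := closure_mono (image_mono (subset_preimage_image π C)) (interior_subset hp)
    rw [closure_image_preimage_eq] at hpS
    exact ⟨π '' C, hpS, (isLindelof_closure_iff hπ).1 hC⟩
  · rintro ⟨S, hpS, hS⟩
    refine ⟨π ⁻¹' S, ⟨⟨clopenIndicator 𝕜 (isClopen_preimage π S),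
      (support_clopenIndicator _).symm⟩,
      (isLindelof_closure_iff hπ).2 (hS.mono (image_preimage_subset π S))⟩, ?_⟩
    rw [closure_image_preimage_eq, (isClopen_mem_toUltrafilter π S).isOpen.interior_eq]
    exact hpS

variable (𝕜 X) in
theorem isOpen_lambdaLindelof : IsOpen (lambdaLindelof 𝕜 X) :=
  isOpen_biUnion fun _ _ => isOpen_interior

instance : LocallyCompactSpace (lambdaLindelof 𝕜 X) :=
  (isOpen_lambdaLindelof 𝕜 X).locallyCompactSpace

variable (𝕜) in
/-- The map from `λ_P X` to the ultrafilters with a countable member that `toUltrafilter π`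
restricts to. -/
def lambdaProj (hπ : ∀ q, IsLindelof (π ⁻¹' {q})) :
    lambdaLindelof 𝕜 X → countableUltrafilters Q :=
  (countableUltrafilters Q).restrictPreimage (toUltrafilter π) ∘
    Homeomorph.setCongr (lambdaLindelof_eq_preimage hπ)

theorem isProperMap_lambdaProj (hπ : ∀ q, IsLindelof (π ⁻¹' {q})) :
    IsProperMap (lambdaProj 𝕜 hπ) :=
  ((continuous_toUltrafilter π).isProperMap.restrictPreimage _).comp
    (Homeomorph.isProperMap _)

variable (𝕜) in
theorem stronglyOmegaBounded_lambdaLindelof (hπ : ∀ q, IsLindelof (π ⁻¹' {q})) :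
    StronglyOmegaBounded (lambdaLindelof 𝕜 X) :=
  (stronglyOmegaBounded_countableUltrafilters Q).of_isProperMap (isProperMap_lambdaProj hπ)

variable (𝕜) in
theorem not_normalSpace_lambdaLindelof [Uncountable Q] (hsurj : Function.Surjective π)
    (hπ : ∀ q, IsLindelof (π ⁻¹' {q})) : ¬ NormalSpace (lambdaLindelof 𝕜 X) := by
  intro hnormal
  obtain ⟨φ, hφ, hleft⟩ := exists_leftInverse_toUltrafilter hsurj
  let σ (u : countableUltrafilters Q) : lambdaLindelof 𝕜 X :=
    ⟨φ u.1, by rw [lambdaLindelof_eq_preimage hπ, mem_preimage, hleft]; exact u.2⟩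
  have hsection : Function.LeftInverse (lambdaProj 𝕜 hπ) σ := fun u =>
    Subtype.ext (hleft u.1)
  exact not_normalSpace_countableUltrafilters Q (hsection.isClosedEmbedding
    (isProperMap_lambdaProj hπ).continuous
    ((hφ.comp continuous_subtype_val).subtype_mk _)).normalSpace

theorem stoneCechUnit_mem_lambdaLindelof (hπ : ∀ q, IsLindelof (π ⁻¹' {q})) (x : X) :
    stoneCechUnit x ∈ lambdaLindelof 𝕜 X := by
  rw [lambdaLindelof_eq_preimage hπ, mem_preimage, toUltrafilter_stoneCechUnit]
  exact ⟨{π x}, mem_singleton _, countable_singleton _⟩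

variable (𝕜) in
/-- The canonical map from `X` to `λ_P X`. -/
def toLambda (hπ : ∀ q, IsLindelof (π ⁻¹' {q})) : C(X, lambdaLindelof 𝕜 X) where
  toFun x := ⟨stoneCechUnit x, stoneCechUnit_mem_lambdaLindelof hπ x⟩
  continuous_toFun := continuous_stoneCechUnit.subtype_mk _

theorem denseRange_toLambda (hπ : ∀ q, IsLindelof (π ⁻¹' {q})) :
    DenseRange (toLambda 𝕜 hπ) := by
  refine (denseRange_stoneCechUnit.preimage
    (isOpen_lambdaLindelof 𝕜 X).isOpenMap_subtype_val).mono ?_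
  rintro y ⟨x, hx⟩
  exact ⟨x, Subtype.ext hx⟩

theorem norm_compContinuous_of_denseRange {Y E : Type*} [TopologicalSpace Y]
    [SeminormedAddCommGroup E] (g : Y →ᵇ E) {h : C(X, Y)} (hh : DenseRange h) :
    ‖g.compContinuous h‖ = ‖g‖ := by
  refine le_antisymm ((BoundedContinuousFunction.norm_le (norm_nonneg _)).2 fun x =>
    g.norm_coe_le_norm _) ((BoundedContinuousFunction.norm_le (norm_nonneg _)).2 fun y => ?_)
  exact hh.induction_on (p := fun y => ‖g y‖ ≤ ‖g.compContinuous h‖) y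
    (isClosed_le g.continuous.norm continuous_const) (g.compContinuous h).norm_coe_le_norm

theorem compContinuous_toLambda_mem (hπ : ∀ q, IsLindelof (π ⁻¹' {q}))
    {g : lambdaLindelof 𝕜 X →ᵇ 𝕜} (hg : HasCompactSupport g) :
    g.compContinuous (toLambda 𝕜 hπ) ∈ CLindelofSubalgebra 𝕜 X := by
  obtain ⟨S, hS, hgS⟩ := exists_countable_forall_mem
    (hg.isCompact.image (isProperMap_lambdaProj hπ).continuous)
  refine (mem_CLindelof_iff hπ).2 (hS.mono ?_)
  rintro _ ⟨x, hx, rfl⟩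
  have hxS : S ∈ toUltrafilter π (stoneCechUnit x) :=
    hgS _ (mem_image_of_mem _ (subset_tsupport g hx))
  simpa using hxS

variable (𝕜) in
/-- The restriction of compactly supported functions from `λ_P X` to `X`. -/
def restrictToLindelof (hπ : ∀ q, IsLindelof (π ⁻¹' {q})) :
    CCompact 𝕜 (lambdaLindelof 𝕜 X) →ₗᵢ[𝕜] CLindelofSubalgebra 𝕜 X where
  toFun g := ⟨g.1.compContinuous (toLambda 𝕜 hπ), compContinuous_toLambda_mem hπ g.2⟩
  map_add' _ _ := rfl
  map_smul' _ _ := rfl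
  norm_map' g := norm_compContinuous_of_denseRange g.1 (denseRange_toLambda hπ)

theorem exists_extend_stoneCech (f : X →ᵇ 𝕜) :
    ∃ F : C(StoneCech X, 𝕜), ∀ x, F (stoneCechUnit x) = f x := by
  let f' (x : X) : Metric.closedBall (0 : 𝕜) ‖f‖ :=
    ⟨f x, mem_closedBall_zero_iff.2 (f.norm_coe_le_norm x)⟩
  have hf' : Continuous f' := f.continuous.subtype_mk _
  refine ⟨⟨fun p => (stoneCechExtend hf' p).1,
    continuous_subtype_val.comp (continuous_stoneCechExtend hf')⟩, fun x => ?_⟩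
  exact congrArg Subtype.val (stoneCechExtend_stoneCechUnit hf' x)

theorem restrictToLindelof_surjective (hπ : ∀ q, IsLindelof (π ⁻¹' {q})) :
    Function.Surjective (restrictToLindelof 𝕜 hπ) := by
  rintro ⟨f, hf⟩
  obtain ⟨F, hF⟩ := exists_extend_stoneCech f
  have hsupport : Function.support F ⊆ {p | π '' Function.support f ∈ toUltrafilter π p} := by
    rw [← closure_image_preimage_eq]
    refine (denseRange_stoneCechUnit.subset_closure_image_preimage_of_isOpen
      F.continuous.isOpen_support).trans (closure_mono (image_mono fun x hx => ?_))
    exact mem_image_of_mem π ((hF x).symm.trans_ne hx)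
  let g : C(lambdaLindelof 𝕜 X, 𝕜) := F.comp ⟨Subtype.val, continuous_subtype_val⟩
  have hg : HasCompactSupport g :=
    HasCompactSupport.of_support_subset_isCompact ((isProperMap_lambdaProj hπ).isCompact_preimage
      (isCompact_mem_countableUltrafilters ((mem_CLindelof_iff hπ).1 hf)))
      fun y hy => hsupport hy
  refine ⟨CCompact.mk g hg, Subtype.ext ?_⟩
  ext x
  exact hF x

theorem isometricallyIsomorphic_lambdaLindelof (hπ : ∀ q, IsLindelof (π ⁻¹' {q})) :
    IsometricallyIsomorphic (CLindelofSubalgebra 𝕜 X) (CCompact 𝕜 (lambdaLindelof 𝕜 X)) :=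
  IsometricallyIsomorphic.symm ⟨LinearIsometryEquiv.ofSurjective (restrictToLindelof 𝕜 hπ)
    (restrictToLindelof_surjective hπ), fun _ _ => rfl⟩

end Lambda

end LindelofSupport

end

open LindelofSupport in
theorem theorem4p4_general {𝕜 : Type*} [RCLike 𝕜] (X : Type*) [TopologicalSpace X]
    [ParacompactSpace X] (hX : LocallyLindelof X) :
    (CompleteSpace (CLindelofSubalgebra 𝕜 X) ∧
      T2Space (lambdaLindelof 𝕜 X) ∧ LocallyCompactSpace (lambdaLindelof 𝕜 X) ∧
      IsometricallyIsomorphic (CLindelofSubalgebra 𝕜 X) (CCompact 𝕜 (lambdaLindelof 𝕜 X)) ∧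
      ∀ (T : Type*) [TopologicalSpace T] [T2Space T] [LocallyCompactSpace T]
        (φ : CLindelofSubalgebra 𝕜 X →ₙₐ[𝕜] CCompact 𝕜 T), Function.Bijective φ →
          Nonempty (T ≃ₜ lambdaLindelof 𝕜 X)) ∧
    CLindelof 𝕜 X = {f : X →ᵇ 𝕜 | IsLindelof (tsupport f)} ∧
    CZero 𝕜 X ⊆ CLindelof 𝕜 X ∧
    (¬ LindelofSpace X → CZero 𝕜 X ⊂ CLindelof 𝕜 X) ∧
    (CCompact 𝕜 (lambdaLindelof 𝕜 X) : Set (lambdaLindelof 𝕜 X →ᵇ 𝕜)) =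
      CZero 𝕜 (lambdaLindelof 𝕜 X) ∧
    CountablyCompactSpace (lambdaLindelof 𝕜 X) ∧
    (¬ LindelofSpace X → ¬ LindelofSpace (lambdaLindelof 𝕜 X) ∧
      ¬ ParacompactSpace (lambdaLindelof 𝕜 X) ∧ ¬ NormalSpace (lambdaLindelof 𝕜 X)) ∧
    (WeaklyLocallyCompactSpace X →
      CLindelof 𝕜 X = {f : X →ᵇ 𝕜 | IsSigmaCompact (tsupport f)}) := by
  obtain ⟨Q, π, hsurj, hπ⟩ := exists_locallyConstant_isLindelof_fiber X hX
  have hiso := isometricallyIsomorphic_lambdaLindelof (𝕜 := 𝕜) hπ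
  have hbounded := stronglyOmegaBounded_lambdaLindelof 𝕜 hπ
  have hnormal (h : ¬ LindelofSpace X) : ¬ NormalSpace (lambdaLindelof 𝕜 X) :=
    have := uncountable_of_not_lindelofSpace hπ h
    not_normalSpace_lambdaLindelof 𝕜 hsurj hπ
  refine ⟨⟨(isClosed_CLindelof 𝕜 hπ).completeSpace_coe, inferInstance, inferInstance, hiso,
      fun T _ _ _ φ hφ => ?_⟩, CLindelof_eq 𝕜 hπ, CZero_subset_CLindelof 𝕜 hπ, fun h => ?_,
    hbounded.CCompact_eq_CZero, hbounded.countablyCompactSpace,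
    fun h => ⟨fun _ => hnormal h inferInstance, fun _ => hnormal h inferInstance, hnormal h⟩,
    fun _ => ?_⟩
  · obtain ⟨ψ, hψ⟩ := hiso.symm.exists_bijective_nonUnitalAlgHom
    exact CCompact.nonempty_homeomorph (φ := φ.comp ψ) (hφ.comp hψ)
  · have := uncountable_of_not_lindelofSpace hπ h
    exact CZero_ssubset_CLindelof 𝕜 hsurj hπ
  · simp only [CLindelof_eq 𝕜 hπ, isSigmaCompact_iff_isLindelof (isClosed_tsupport _)]

theorem theorem4p4 {𝕜 : Type*} [RCLike 𝕜] (X : Type*) [TopologicalSpace X] [T2Space X]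
    [ParacompactSpace X] (hX : LindelofSupport.LocallyLindelof X) :
    (∃ A : NonUnitalSubalgebra 𝕜 (X →ᵇ 𝕜),
      (A : Set (X →ᵇ 𝕜)) = LindelofSupport.CLindelof 𝕜 X ∧
      CompleteSpace A ∧
      (T2Space (LindelofSupport.lambdaLindelof 𝕜 X) ∧
        LocallyCompactSpace (LindelofSupport.lambdaLindelof 𝕜 X) ∧
        LindelofSupport.IsometricallyIsomorphic A
          (LindelofSupport.CCompact 𝕜 (LindelofSupport.lambdaLindelof 𝕜 X))) ∧
      (∀ (T : Type*) [TopologicalSpace T] [T2Space T] [LocallyCompactSpace T],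
        LindelofSupport.IsometricallyIsomorphic A (LindelofSupport.CCompact 𝕜 T) →
          Nonempty (T ≃ₜ LindelofSupport.lambdaLindelof 𝕜 X))) ∧
    LindelofSupport.CLindelof 𝕜 X = {f : X →ᵇ 𝕜 | IsLindelof (tsupport f)} ∧
    LindelofSupport.CZero 𝕜 X ⊆ LindelofSupport.CLindelof 𝕜 X ∧
    (¬ LindelofSpace X → LindelofSupport.CZero 𝕜 X ⊂ LindelofSupport.CLindelof 𝕜 X) ∧
    (LindelofSupport.CCompact 𝕜 (LindelofSupport.lambdaLindelof 𝕜 X) :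
        Set (LindelofSupport.lambdaLindelof 𝕜 X →ᵇ 𝕜)) =
      LindelofSupport.CZero 𝕜 (LindelofSupport.lambdaLindelof 𝕜 X) ∧
    CountablyCompactSpace (LindelofSupport.lambdaLindelof 𝕜 X) ∧
    (¬ LindelofSpace X →
      ¬ LindelofSpace (LindelofSupport.lambdaLindelof 𝕜 X) ∧
      ¬ ParacompactSpace (LindelofSupport.lambdaLindelof 𝕜 X)) ∧
    (LocallyCompactSpace X →
      LindelofSupport.CLindelof 𝕜 X = {f : X →ᵇ 𝕜 | IsSigmaCompact (tsupport f)} ∧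
      (¬ LindelofSpace X → ¬ NormalSpace (LindelofSupport.lambdaLindelof 𝕜 X))) := by
  obtain ⟨⟨hcomplete, hT2, hLC, hiso, huniq⟩, hL, hsub, hssub, hc0, hcc, hnormal, hσ⟩ :=
    theorem4p4_general (𝕜 := 𝕜) X hX
  exact ⟨⟨LindelofSupport.CLindelofSubalgebra 𝕜 X, rfl, hcomplete, ⟨hT2, hLC, hiso⟩,
      fun T _ _ _ h => h.exists_bijective_nonUnitalAlgHom.elim (huniq T)⟩,
    hL, hsub, hssub, hc0, hcc, fun h => ⟨(hnormal h).1, (hnormal h).2.1⟩,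
    fun _ => ⟨hσ inferInstance, fun h => (hnormal h).2.2⟩⟩
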